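/- Let $\omega\in\mathbb{R}$, $\omega\neq 0$. Let $p\in C^1([0,\infty))$ satisfy $p(t)>0$ and $p'(t)<0$ for all $t\ge 0$, $\int_0^\infty p(t)\,dt=\infty$ and $\int_0^\infty p(t)^2\,dt<\infty$, and let $f\in L^1_{\mathrm{loc}}([0,\infty))$ be real-valued. Let $x$ be the solution of $$x''(t)+p(t)x'(t)+\omega^2x(t)=f(t),\quad t\ge 0,\qquad x(0)=0,\ x'(0)=0,$$ that is, $x$ is differentiable on $[0,\infty)$, $x'$ is absolutely continuous on each compact interval $[0,T]$, and the equation holds for almost every $t\geq 0$. Put $$y_1(t)=\int_0^t e^{-\omega^2(t-s)}f(s)\,ds,\qquad A(t)=\exp\Big(\tfrac12\int_0^t p(\tau)\,d\tau\Big),\qquad E(t,s)=\exp\Big(-\tfrac12\int_s^t p(\tau)\,d\tau\Big),$$ $$L_1(t,s)=\omega\sin(\omega(t-s))+\cos(\omega(t-s)),\qquad L_2(t,s)=\omega^2\cos(\omega(t-s))-\omega\sin(\omega(t-s)).$$ Theorem (Unified Equivalence of Asymptotic Decay). The following three statements are equivalent: (1) $x(t)\to 0$ and $x'(t)\to 0$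 as $t\to\infty$. (2) As $t\to\infty$, $y_1(t)\to 0$, $\int_0^t\cos(\omega s)A(s)y_1(s)\,ds=o(A(t))$ and $\int_0^t\sin(\omega s)A(s)y_1(s)\,ds=o(A(t))$. (3) As $t\to\infty$, $y_1(t)\to 0$, $\int_0^tE(t,s)L_1(t,s)y_1(s)\,ds\to 0$ and $\int_0^tE(t,s)L_2(t,s)y_1(s)\,ds\to 0$. -/

import Mathlib

open Set Filter Topology MeasureTheory Asymptotics

namespace DampedOscillator

/-- Standing hypotheses on the damping coefficient, viewed as a function on `[0, ∞)`. -/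
structure IsAdmissibleDamping (p : ℝ → ℝ) : Prop where
  contDiffOn : ContDiffOn ℝ 1 p (Ici 0)
  pos : ∀ t, 0 ≤ t → 0 < p t
  deriv_neg : ∀ t, 0 ≤ t → derivWithin p (Ici 0) t < 0
  not_integrable : ¬ IntegrableOn p (Ioi 0)
  sq_integrable : IntegrableOn (fun t => p t ^ 2) (Ioi 0)

/-- The derivative of a function on `[0, ∞)` (one-sided at the endpoint `0`). -/
noncomputable def velocity (x : ℝ → ℝ) : ℝ → ℝ := derivWithin x (Ici 0)

/-- `x` solves `x'' + p x' + ω² x = f` on `[0, ∞)` with `x(0) = x'(0) = 0`, in the sense that is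
standard for a locally integrable right-hand side: `x` is differentiable on `[0, ∞)`, its
derivative is absolutely continuous on every compact interval `[0, T]`, and the equation holds
at almost every time. -/
structure IsRestSolution (p f : ℝ → ℝ) (ω : ℝ) (x : ℝ → ℝ) : Prop where
  differentiableOn : DifferentiableOn ℝ x (Ici 0)
  absolutelyContinuous : ∀ T, 0 ≤ T → AbsolutelyContinuousOnInterval (velocity x) 0 T
  equation : ∀ᵐ t ∂(volume.restrict (Ioi (0 : ℝ))),
    deriv (velocity x) t + p t * velocity x t + ω ^ 2 * x t = f t
  initial_position : x 0 = 0
  initial_velocity : velocity x 0 = 0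

/-- The exponential filter `y₁(t) = ∫₀ᵗ e^{-ω²(t-s)} f(s) ds`. -/
noncomputable def y₁ (f : ℝ → ℝ) (ω t : ℝ) : ℝ :=
  ∫ s in (0 : ℝ)..t, Real.exp (-ω ^ 2 * (t - s)) * f s

/-- The weight `A(t) = exp(½ ∫₀ᵗ p(τ) dτ)`. -/
noncomputable def A (p : ℝ → ℝ) (t : ℝ) : ℝ :=
  Real.exp (1 / 2 * ∫ τ in (0 : ℝ)..t, p τ)

/-- The decay kernel `E(t, s) = exp(-½ ∫ₛᵗ p(τ) dτ)`. -/
noncomputable def E (p : ℝ → ℝ) (t s : ℝ) : ℝ :=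
  Real.exp (-(1 / 2) * ∫ τ in s..t, p τ)

/-- The sinusoidal kernel governing `x`. -/
noncomputable def L₁ (ω t s : ℝ) : ℝ :=
  ω * Real.sin (ω * (t - s)) + Real.cos (ω * (t - s))

/-- The sinusoidal kernel governing `x'`. -/
noncomputable def L₂ (ω t s : ℝ) : ℝ :=
  ω ^ 2 * Real.cos (ω * (t - s)) - ω * Real.sin (ω * (t - s))

end DampedOscillator

/-! Since `y₁` solves `y' + ω² y = f`, subtracting it from `x'` cancels the rough forcing: `x' - y₁`
is differentiable for `t > 0`, with derivative `ω² y₁ - p x' - ω² x`. Multiplying by `A` removes the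
damping: `z = A x` and `w = A (x' - y₁) + (p/2) z` satisfy `z' = w + A y₁` and `w' = -ω² z + q z +
ω² A y₁ - y₁ A'`, with `q = p'/2 + p²/4`. Here `q` is integrable, because `p` is decreasing and
positive and `p²` is integrable.

In coordinates rotating with frequency `ω` the unperturbed oscillation disappears. Each coordinate
becomes a constant combination of `∫ cos(ωs) A y₁` and `∫ sin(ωs) A y₁`, plus a term from `q z` and
a term from `y₁ A'` (`rotatingFst_eq`, `rotatingSnd_eq`). If `y₁ → 0`, the `A'` term is an average
and hence `o(A)`; if `x` is bounded, integrability of `q` and monotonicity of `A` make the `q` term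
`o(A)`. So the two response integrals are `o(A)` exactly when the rotating coordinates are, that is,
when `x` and `x'` tend to zero. Boundedness of `x` is trivial when `x → 0`; from the response
integrals it comes from a Gronwall argument (`exists_bound_of_isLittleO_response`).

That decay of `x` and `x'` forces `y₁ → 0` is exponential averaging (`tendsto_y₁`). The kernel form
follows from `A(t) E(t,s) = A(s)` and the addition formulas: it is a bounded, boundedly invertible
recombination of the response integrals. -/

namespace DampedOscillator

/-! ### Calculus on the half-line: primitives, averaging and Gronwall estimates. -/

section HalfLine

variable {F G a b g k m : ℝ → ℝ}

lemma intervalIntegrable_of_continuousOn_Ici (hg : ContinuousOn g (Ici 0)) {s t : ℝ}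
    (hs : 0 ≤ s) (ht : 0 ≤ t) : IntervalIntegrable g volume s t :=
  (hg.mono fun _ hr => (le_inf hs ht).trans hr.1).intervalIntegrable

lemma integral_split (hg : ContinuousOn g (Ici 0)) {s t : ℝ} (hs : 0 ≤ s) (ht : 0 ≤ t) :
    ∫ r in (0 : ℝ)..t, g r = (∫ r in (0 : ℝ)..s, g r) + ∫ r in s..t, g r :=
  (intervalIntegral.integral_add_adjacent_intervals
    (intervalIntegrable_of_continuousOn_Ici hg le_rfl hs)
    (intervalIntegrable_of_continuousOn_Ici hg hs ht)).symm

lemma hasDerivAt_primitive (hg : ContinuousOn g (Ici 0)) {t : ℝ} (ht : 0 < t) :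
    HasDerivAt (fun u => ∫ s in (0 : ℝ)..u, g s) (g t) t :=
  intervalIntegral.integral_hasDerivAt_right
    (intervalIntegrable_of_continuousOn_Ici hg le_rfl ht.le)
    ((hg.mono Ioi_subset_Ici_self).stronglyMeasurableAtFilter isOpen_Ioi t ht)
    (hg.continuousAt (Ici_mem_nhds ht))

lemma continuousOn_primitive (hg : ContinuousOn g (Ici 0)) :
    ContinuousOn (fun u => ∫ s in (0 : ℝ)..u, g s) (Ici 0) := by
  intro t ht
  have ht' : (0 : ℝ) ≤ t := ht
  have hc : ContinuousOn (fun u => ∫ s in (0 : ℝ)..u, g s) (uIcc 0 (t + 1)) :=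
    intervalIntegral.continuousOn_primitive_interval' (b₁ := 0) (b₂ := t + 1)
      (intervalIntegrable_of_continuousOn_Ici hg le_rfl (by linarith)) (by simp)
  rw [uIcc_of_le (by linarith)] at hc
  refine (hc t ⟨ht', by linarith⟩).mono_of_mem_nhdsWithin ?_
  filter_upwards [self_mem_nhdsWithin, mem_nhdsWithin_of_mem_nhds (Iio_mem_nhds (lt_add_one t))]
    with u hu hu'
  exact ⟨hu, le_of_lt hu'⟩

/-- At the endpoint `0` only continuity is required, since derivatives there are one-sided. -/
lemma integral_eq_sub_of_hasDerivAt_Ioi (hF : ContinuousOn F (Ici 0))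
    (hd : ∀ t, 0 < t → HasDerivAt F (G t) t) (hG : ContinuousOn G (Ici 0)) {t : ℝ} (ht : 0 ≤ t) :
    ∫ s in (0 : ℝ)..t, G s = F t - F 0 :=
  intervalIntegral.integral_eq_sub_of_hasDerivAt_of_le ht (hF.mono Icc_subset_Ici_self)
    (fun s hs => hd s hs.1) (intervalIntegrable_of_continuousOn_Ici hG le_rfl ht)

lemma isLittleO_of_le_const_add (ha : Tendsto a atTop atTop)
    (h : ∀ ε > 0, ∃ C, ∀ᶠ t in atTop, |F t| ≤ C + ε * a t) : F =o[atTop] a := by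
  refine isLittleO_iff.2 fun ε hε => ?_
  obtain ⟨C, hC⟩ := h (ε / 2) (by positivity)
  filter_upwards [hC, ha.eventually_ge_atTop (C / (ε / 2)), ha.eventually_ge_atTop 0]
    with t h1 h2 h3
  rw [div_le_iff₀ (by positivity)] at h2
  rw [Real.norm_eq_abs, Real.norm_eq_abs, abs_of_nonneg h3]
  linarith

lemma abs_integral_le (hk : ContinuousOn k (Ici 0)) {s t : ℝ} (hs : 0 ≤ s)
    (hst : s ≤ t) (h : ∀ r, s ≤ r → r ≤ t → |g r| ≤ k r) :
    |∫ r in s..t, g r| ≤ ∫ r in s..t, k r := by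
  rw [← Real.norm_eq_abs]
  exact intervalIntegral.norm_integral_le_of_norm_le hst
    (Eventually.of_forall fun r hr => h r hr.1.le hr.2)
    (intervalIntegrable_of_continuousOn_Ici hk hs (hs.trans hst))

/-- Averages of a function that tends to zero, against a nonnegative density with divergent
primitive, tend to zero. -/
lemma isLittleO_integral_of_tendsto_zero (hb : ContinuousOn b (Ici 0)) (hb0 : ∀ t, 0 ≤ t → 0 ≤ b t)
    (hg : ContinuousOn g (Ici 0)) (hg0 : Tendsto g atTop (𝓝 0)) (ha : Tendsto a atTop atTop)
    (hab : ∀ t, 0 ≤ t → ∫ s in (0 : ℝ)..t, b s = a t - a 0) :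
    (fun t => ∫ s in (0 : ℝ)..t, g s * b s) =o[atTop] a := by
  refine isLittleO_of_le_const_add ha fun ε hε => ?_
  obtain ⟨T, hT⟩ := eventually_atTop.1 (hg0.eventually (Metric.closedBall_mem_nhds 0 hε))
  set S := max T 0
  have hS : 0 ≤ S := le_max_right _ _
  -- Beyond `S` the integral is at most `ε * (a t - a S)`; the second summand of the constant is its
  -- lower-limit term.
  refine ⟨|∫ s in (0 : ℝ)..S, g s * b s| - ε * a S, ?_⟩
  filter_upwards [eventually_ge_atTop S] with t ht
  rw [integral_split (g := fun s => g s * b s) (hg.mul hb) hS (hS.trans ht)]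
  have h1 : |∫ s in S..t, g s * b s| ≤ ∫ s in S..t, ε * b s := by
    refine abs_integral_le (continuousOn_const.mul hb) hS ht fun r hr _ => ?_
    have hr0 := hb0 r (hS.trans hr)
    rw [abs_mul, abs_of_nonneg hr0]
    have := hT r ((le_max_left _ _).trans hr)
    rw [Real.dist_0_eq_abs] at this
    exact mul_le_mul_of_nonneg_right this hr0
  rw [intervalIntegral.integral_const_mul] at h1
  have h2 := integral_split hb hS (hS.trans ht)
  rw [hab _ hS, hab _ (hS.trans ht)] at h2
  have h3 : ∫ s in S..t, b s = a t - a S := by linarith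
  rw [h3] at h1
  linarith [abs_add_le (∫ s in (0 : ℝ)..S, g s * b s) (∫ s in S..t, g s * b s)]

lemma exists_integral_tail_le (hk : ContinuousOn k (Ici 0)) (hki : IntegrableOn k (Ioi 0))
    {ε : ℝ} (hε : 0 < ε) : ∃ T, 0 ≤ T ∧ ∀ t, T ≤ t → ∫ s in T..t, k s ≤ ε := by
  have h := intervalIntegral_tendsto_integral_Ioi 0 hki tendsto_id
  obtain ⟨T, hT⟩ := eventually_atTop.1
    (h.eventually (Metric.closedBall_mem_nhds _ (half_pos hε)))
  refine ⟨max T 0, le_max_right _ _, fun t ht => ?_⟩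
  have h1 := hT _ (le_max_left T 0)
  have h2 := hT _ ((le_max_left T 0).trans ht)
  simp only [id, Real.dist_eq, abs_le] at h1 h2
  have h3 := integral_split hk (le_max_right T 0) ((le_max_right T 0).trans ht)
  linarith [h1.1, h2.2]

/-- On a tail where `k` has mass at most `ε`, monotonicity replaces `a s` by its final value `a t`,
so the tail contributes at most `ε * a t`; the initial piece is a constant. -/
lemma isLittleO_integral_of_le_integrable_mul (hk : ContinuousOn k (Ici 0))
    (hki : IntegrableOn k (Ioi 0)) (hk0 : ∀ t, 0 ≤ t → 0 ≤ k t) (ha : Tendsto a atTop atTop)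
    (ham : MonotoneOn a (Ici 0)) (ha0 : ∀ t, 0 ≤ t → 0 ≤ a t)
    (hg : ContinuousOn g (Ici 0)) (h : ∀ t, 0 ≤ t → |g t| ≤ k t * a t) :
    (fun t => ∫ s in (0 : ℝ)..t, g s) =o[atTop] a := by
  refine isLittleO_of_le_const_add ha fun ε hε => ?_
  obtain ⟨T, hT, hkT⟩ := exists_integral_tail_le hk hki hε
  refine ⟨|∫ s in (0 : ℝ)..T, g s|, ?_⟩
  filter_upwards [eventually_ge_atTop T] with t ht
  have ht0 := hT.trans ht
  rw [integral_split hg hT ht0]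
  have h1 : |∫ s in T..t, g s| ≤ ∫ s in T..t, k s * a t := by
    refine abs_integral_le (hk.mul continuousOn_const) hT ht fun r hr hrt => ?_
    have hr0 := hT.trans hr
    exact (h r hr0).trans (mul_le_mul_of_nonneg_left (ham hr0 ht0 hrt) (hk0 r hr0))
  rw [intervalIntegral.integral_mul_const] at h1
  have h2 := mul_le_mul_of_nonneg_right (hkT t ht) (ha0 t ht0)
  linarith [abs_add_le (∫ s in (0 : ℝ)..T, g s) (∫ s in T..t, g s)]

/-- Compactness controls the initial interval, where `1 ≤ a` turns a constant bound into a multiple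
of `a`. -/
lemma exists_bound_of_isBigO_of_continuousOn (hF : ContinuousOn F (Ici 0))
    (ha : ∀ t, 0 ≤ t → 1 ≤ a t) (h : F =O[atTop] a) :
    ∃ C, 0 ≤ C ∧ ∀ t, 0 ≤ t → |F t| ≤ C * a t := by
  obtain ⟨c, hc⟩ := h.bound
  obtain ⟨T, hT⟩ := eventually_atTop.1 hc
  obtain ⟨D, hD⟩ := (isCompact_Icc (a := (0 : ℝ)) (b := T)).exists_bound_of_continuousOn
    (hF.mono Icc_subset_Ici_self)
  refine ⟨max (max c D) 0, le_max_right _ _, fun t ht => ?_⟩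
  have ha1 := ha t ht
  rcases le_total T t with hTt | hTt
  · have := hT t hTt
    rw [Real.norm_eq_abs, Real.norm_eq_abs, abs_of_nonneg (by linarith : 0 ≤ a t)] at this
    exact this.trans (mul_le_mul_of_nonneg_right
      ((le_max_left _ _).trans (le_max_left _ _)) (by linarith))
  · have h1 := hD t ⟨ht, hTt⟩
    rw [Real.norm_eq_abs] at h1
    have h2 : D ≤ max (max c D) 0 := (le_max_right _ _).trans (le_max_left _ _)
    have h3 : 0 ≤ max (max c D) 0 := le_max_right _ _
    nlinarith

/-- A Gronwall bound: an integrable kernel keeps the solution of an integral inequality bounded. -/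
lemma exists_bound_of_le_const_add_integral (hk : ContinuousOn k (Ici 0))
    (hki : IntegrableOn k (Ioi 0)) (hk0 : ∀ t, 0 ≤ t → 0 ≤ k t) (hm : ContinuousOn m (Ici 0))
    (hm0 : ∀ t, 0 ≤ t → 0 ≤ m t) {K : ℝ}
    (h : ∀ t, 0 ≤ t → m t ≤ K + ∫ s in (0 : ℝ)..t, k s * m s) :
    ∃ M, ∀ t, 0 ≤ t → m t ≤ M := by
  -- With tail mass at most `1/2`, the integral beyond `T` is absorbed at a maximum point `r` of `m`
  -- on `[T, t]`: `m r ≤ K' + m r / 2`, hence `m r ≤ 2 * K'`. No exponential is needed.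
  obtain ⟨T, hT, hkT⟩ := exists_integral_tail_le hk hki (half_pos one_pos)
  obtain ⟨D, hD⟩ := (isCompact_Icc (a := (0 : ℝ)) (b := T)).exists_bound_of_continuousOn
    (hm.mono Icc_subset_Ici_self)
  set K' := K + ∫ s in (0 : ℝ)..T, k s * m s
  refine ⟨max D (2 * K'), fun t ht => ?_⟩
  rcases le_total t T with htT | hTt
  · exact ((le_abs_self _).trans (hD t ⟨ht, htT⟩)).trans (le_max_left _ _)
  obtain ⟨r, ⟨hTr, hrt⟩, hr⟩ := (isCompact_Icc (a := T) (b := t)).exists_isMaxOn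
    ⟨T, left_mem_Icc.2 hTt⟩ (hm.mono fun s hs => hT.trans hs.1)
  have hr0 := hT.trans hTr
  have h1 := h r hr0
  rw [integral_split (g := fun s => k s * m s) (hk.mul hm) hT hr0] at h1
  have h2 : |∫ s in T..r, k s * m s| ≤ ∫ s in T..r, k s * m r := by
    refine abs_integral_le (hk.mul continuousOn_const) hT hTr fun s hs hsr => ?_
    have hs0 := hT.trans hs
    rw [abs_mul, abs_of_nonneg (hk0 s hs0), abs_of_nonneg (hm0 s hs0)]
    exact mul_le_mul_of_nonneg_left (hr ⟨hs, hsr.trans hrt⟩) (hk0 s hs0)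
  rw [intervalIntegral.integral_mul_const] at h2
  have h3 := mul_le_mul_of_nonneg_right (hkT r hTr) (hm0 r hr0)
  have h4 : m t ≤ m r := hr (right_mem_Icc.2 hTt)
  have h5 := le_abs_self (∫ s in T..r, k s * m s)
  exact le_trans (by linarith) (le_max_right _ _)

end HalfLine

/-! ### The damping coefficient, the weight `A` and the integrable perturbation. -/

section Damping

variable {p : ℝ → ℝ}

namespace IsAdmissibleDamping

lemma continuousOn (hp : IsAdmissibleDamping p) : ContinuousOn p (Ici 0) :=
  hp.contDiffOn.continuousOn

lemma continuousOn_derivWithin (hp : IsAdmissibleDamping p) :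
    ContinuousOn (derivWithin p (Ici 0)) (Ici 0) :=
  hp.contDiffOn.continuousOn_derivWithin (uniqueDiffOn_Ici 0) le_rfl

lemma hasDerivAt (hp : IsAdmissibleDamping p) {t : ℝ} (ht : 0 < t) :
    HasDerivAt p (derivWithin p (Ici 0) t) t :=
  ((hp.contDiffOn.differentiableOn one_ne_zero t ht.le).hasDerivWithinAt).hasDerivAt
    (Ici_mem_nhds ht)

lemma integral_derivWithin (hp : IsAdmissibleDamping p) {t : ℝ} (ht : 0 ≤ t) :
    ∫ s in (0 : ℝ)..t, derivWithin p (Ici 0) s = p t - p 0 :=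
  integral_eq_sub_of_hasDerivAt_Ioi hp.continuousOn (fun _ => hp.hasDerivAt)
    hp.continuousOn_derivWithin ht

lemma le_initial (hp : IsAdmissibleDamping p) {t : ℝ} (ht : 0 ≤ t) : p t ≤ p 0 := by
  have h := hp.integral_derivWithin ht
  have h2 : 0 ≤ ∫ s in (0 : ℝ)..t, -derivWithin p (Ici 0) s :=
    intervalIntegral.integral_nonneg ht fun s hs => by linarith [hp.deriv_neg s hs.1]
  rw [intervalIntegral.integral_neg] at h2
  linarith

/-- As `p` decreases and stays positive, its total variation on `[0, t]` is `p 0 - p t ≤ p 0`. -/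
lemma integrableOn_derivWithin (hp : IsAdmissibleDamping p) :
    IntegrableOn (derivWithin p (Ici 0)) (Ioi 0) := by
  refine integrableOn_Ioi_of_intervalIntegral_norm_bounded (l := atTop) (b := id) (p 0) 0
    (fun t => ?_) tendsto_id ?_
  · exact ((hp.continuousOn_derivWithin.mono Icc_subset_Ici_self).integrableOn_Icc).mono_set
      Ioc_subset_Icc_self
  · filter_upwards [eventually_ge_atTop 0] with t ht
    have : ∫ s in (0 : ℝ)..t, ‖derivWithin p (Ici 0) s‖
        = ∫ s in (0 : ℝ)..t, -derivWithin p (Ici 0) s := by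
      refine intervalIntegral.integral_congr fun s hs => ?_
      rw [uIcc_of_le ht] at hs
      simp only [Real.norm_eq_abs, abs_of_neg (hp.deriv_neg s hs.1)]
    rw [id, this, intervalIntegral.integral_neg, hp.integral_derivWithin ht]
    linarith [hp.pos t ht]

end IsAdmissibleDamping

/-- The perturbation of `ω²` left after removing the damping term by the weight `A`. -/
noncomputable def perturbation (p : ℝ → ℝ) (t : ℝ) : ℝ :=
  derivWithin p (Ici 0) t / 2 + p t ^ 2 / 4

lemma continuousOn_perturbation (hp : IsAdmissibleDamping p) :
    ContinuousOn (perturbation p) (Ici 0) :=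
  (hp.continuousOn_derivWithin.div_const _).add ((hp.continuousOn.pow 2).div_const _)

lemma integrableOn_perturbation (hp : IsAdmissibleDamping p) :
    IntegrableOn (perturbation p) (Ioi 0) :=
  (hp.integrableOn_derivWithin.div_const _).add (hp.sq_integrable.div_const _)

lemma A_pos (p : ℝ → ℝ) (t : ℝ) : 0 < A p t := Real.exp_pos _

lemma A_zero (p : ℝ → ℝ) : A p 0 = 1 := by simp [A]

lemma continuousOn_A (hp : IsAdmissibleDamping p) : ContinuousOn (A p) (Ici 0) :=
  Real.continuous_exp.comp_continuousOn
    (continuousOn_const.mul (continuousOn_primitive hp.continuousOn))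

lemma hasDerivAt_A (hp : IsAdmissibleDamping p) {t : ℝ} (ht : 0 < t) :
    HasDerivAt (A p) (p t / 2 * A p t) t := by
  have h := ((hasDerivAt_primitive hp.continuousOn ht).const_mul (1 / 2)).exp
  refine h.congr_deriv ?_
  change A p t * (1 / 2 * p t) = _
  ring

lemma primitive_mono (hp : IsAdmissibleDamping p) {s t : ℝ} (hs : 0 ≤ s) (hst : s ≤ t) :
    ∫ r in (0 : ℝ)..s, p r ≤ ∫ r in (0 : ℝ)..t, p r := by
  rw [integral_split hp.continuousOn hs (hs.trans hst)]
  have := intervalIntegral.integral_nonneg (μ := volume) hst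
    fun r hr => (hp.pos r (hs.trans hr.1)).le
  linarith

lemma monotoneOn_A (hp : IsAdmissibleDamping p) : MonotoneOn (A p) (Ici 0) := by
  intro s hs t _ hst
  have := primitive_mono hp hs hst
  exact Real.exp_le_exp.2 (by linarith)

lemma one_le_A (hp : IsAdmissibleDamping p) {t : ℝ} (ht : 0 ≤ t) : 1 ≤ A p t :=
  (A_zero p).symm.trans_le (monotoneOn_A hp self_mem_Ici ht ht)

lemma tendsto_A (hp : IsAdmissibleDamping p) : Tendsto (A p) atTop atTop := by
  refine Real.tendsto_exp_atTop.comp (Tendsto.const_mul_atTop (by norm_num) ?_)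
  refine tendsto_atTop.2 fun c => ?_
  -- The primitive of `p` is monotone, so if it is not eventually above `c` it never exceeds `c`,
  -- and the positive function `p` would be integrable.
  by_contra hc
  refine hp.not_integrable (integrableOn_Ioi_of_intervalIntegral_norm_bounded (l := atTop)
    (b := id) c 0 (fun t => ?_) tendsto_id ?_)
  · exact ((hp.continuousOn.mono Icc_subset_Ici_self).integrableOn_Icc).mono_set
      Ioc_subset_Icc_self
  · filter_upwards [eventually_ge_atTop 0] with t ht
    have : ∫ s in (0 : ℝ)..t, ‖p s‖ = ∫ s in (0 : ℝ)..t, p s := by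
      refine intervalIntegral.integral_congr fun s hs => ?_
      rw [uIcc_of_le ht] at hs
      simp only [Real.norm_eq_abs, abs_of_pos (hp.pos s hs.1)]
    rw [id, this]
    by_contra! hct
    refine hc ?_
    filter_upwards [eventually_ge_atTop t] with u hu
    exact hct.le.trans (primitive_mono hp ht hu)

lemma E_mul_A (hp : IsAdmissibleDamping p) {s t : ℝ} (hs : 0 ≤ s) (ht : 0 ≤ t) :
    A p t * E p t s = A p s := by
  rw [A, A, E, ← Real.exp_add, integral_split hp.continuousOn hs ht]
  ring_nf

lemma isLittleO_A_iff {F u : ℝ → ℝ} (h : ∀ t, 0 ≤ t → F t = A p t * u t) :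
    F =o[atTop] A p ↔ Tendsto u atTop (𝓝 0) := by
  rw [isLittleO_iff_tendsto fun t ht => absurd ht (A_pos p t).ne']
  refine tendsto_congr' ?_
  filter_upwards [eventually_ge_atTop 0] with t ht
  rw [h t ht, mul_div_cancel_left₀ _ (A_pos p t).ne']

end Damping

/-! ### Bounded changes of basis for pairs of negligible functions. -/

section Combination

variable {F G a α β : ℝ → ℝ}

lemma isLittleO_combination (hF : F =o[atTop] a) (hG : G =o[atTop] a)
    (hα : ∃ c, ∀ t, |α t| ≤ c) (hβ : ∃ c, ∀ t, |β t| ≤ c) :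
    (fun t => α t * F t + β t * G t) =o[atTop] a := by
  obtain ⟨c, hc⟩ := hα
  obtain ⟨d, hd⟩ := hβ
  have h1 : α =O[atTop] (fun _ => (1 : ℝ)) := .of_bound c (.of_forall fun t => by simpa using hc t)
  have h2 : β =O[atTop] (fun _ => (1 : ℝ)) := .of_bound d (.of_forall fun t => by simpa using hd t)
  simpa using (h1.mul_isLittleO hF).add (h2.mul_isLittleO hG)

/-- Two functions are negligible iff two bounded combinations of them are, when the latter
determine the former. -/
lemma isLittleO_pair_congr {F' G' α' β' γ δ γ' δ' : ℝ → ℝ}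
    (hF : ∀ᶠ t in atTop, F' t = α t * F t + β t * G t)
    (hG : ∀ᶠ t in atTop, G' t = γ t * F t + δ t * G t)
    (hF' : ∀ᶠ t in atTop, F t = α' t * F' t + β' t * G' t)
    (hG' : ∀ᶠ t in atTop, G t = γ' t * F' t + δ' t * G' t)
    (hα : ∃ c, ∀ t, |α t| ≤ c) (hβ : ∃ c, ∀ t, |β t| ≤ c) (hγ : ∃ c, ∀ t, |γ t| ≤ c)
    (hδ : ∃ c, ∀ t, |δ t| ≤ c) (hα' : ∃ c, ∀ t, |α' t| ≤ c) (hβ' : ∃ c, ∀ t, |β' t| ≤ c)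
    (hγ' : ∃ c, ∀ t, |γ' t| ≤ c) (hδ' : ∃ c, ∀ t, |δ' t| ≤ c) :
    (F =o[atTop] a ∧ G =o[atTop] a) ↔ (F' =o[atTop] a ∧ G' =o[atTop] a) :=
  ⟨fun h => ⟨(isLittleO_combination h.1 h.2 hα hβ).congr' (hF.mono fun _ h => h.symm) .rfl,
      (isLittleO_combination h.1 h.2 hγ hδ).congr' (hG.mono fun _ h => h.symm) .rfl⟩,
    fun h => ⟨(isLittleO_combination h.1 h.2 hα' hβ').congr' (hF'.mono fun _ h => h.symm) .rfl,
      (isLittleO_combination h.1 h.2 hγ' hδ').congr' (hG'.mono fun _ h => h.symm) .rfl⟩⟩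

lemma exists_bound_trigonometric (ω r s : ℝ) :
    ∃ c, ∀ t, |r * Real.cos (ω * t) + s * Real.sin (ω * t)| ≤ c := by
  refine ⟨|r| + |s|, fun t => (abs_add_le _ _).trans (add_le_add ?_ ?_)⟩ <;> rw [abs_mul]
  · exact mul_le_of_le_one_right (abs_nonneg _) (Real.abs_cos_le_one _)
  · exact mul_le_of_le_one_right (abs_nonneg _) (Real.abs_sin_le_one _)

end Combination

/-! ### Removal of the forcing and decay of the exponential filter. -/

section Solution

variable {ω : ℝ} {p f x : ℝ → ℝ}

namespace IsRestSolution

lemma continuousOn (hx : IsRestSolution p f ω x) : ContinuousOn x (Ici 0) :=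
  hx.differentiableOn.continuousOn

lemma hasDerivAt (hx : IsRestSolution p f ω x) {t : ℝ} (ht : 0 < t) :
    HasDerivAt x (velocity x t) t :=
  (hx.differentiableOn t ht.le).hasDerivWithinAt.hasDerivAt (Ici_mem_nhds ht)

lemma continuousOn_velocity (hx : IsRestSolution p f ω x) :
    ContinuousOn (velocity x) (Ici 0) := by
  intro t ht
  have ht' : (0 : ℝ) ≤ t := ht
  have hc := (hx.absolutelyContinuous (t + 1) (by linarith)).continuousOn
  rw [uIcc_of_le (by linarith)] at hc
  refine (hc t ⟨ht', by linarith⟩).mono_of_mem_nhdsWithin ?_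
  filter_upwards [self_mem_nhdsWithin, mem_nhdsWithin_of_mem_nhds (Iio_mem_nhds (lt_add_one t))]
    with u hu hu'
  exact ⟨hu, le_of_lt hu'⟩

/-- The filter equation for the velocity minus `y₁`, from which the forcing has disappeared. -/
lemma exp_mul_velocity_sub (hf : LocallyIntegrableOn f (Ici 0))
    (hx : IsRestSolution p f ω x) {t : ℝ} (ht : 0 ≤ t) :
    Real.exp (ω ^ 2 * t) * (velocity x t - y₁ f ω t) =
      ∫ s in (0 : ℝ)..t,
        (ω ^ 2 * velocity x s - p s * velocity x s - ω ^ 2 * x s) * Real.exp (ω ^ 2 * s) := by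
  have hexp : ContDiff ℝ 1 fun s : ℝ => Real.exp (ω ^ 2 * s) := by fun_prop
  have hac : AbsolutelyContinuousOnInterval (fun s : ℝ => Real.exp (ω ^ 2 * s)) 0 t :=
    hexp.contDiffOn.absolutelyContinuousOnInterval
  have hvac := hx.absolutelyContinuous t ht
  -- Integration by parts for absolutely continuous functions: the velocity need not be
  -- differentiable everywhere.
  have h1 := hac.integral_deriv_mul_eq_sub hvac
  have hderiv : ∀ s : ℝ, deriv (fun s : ℝ => Real.exp (ω ^ 2 * s)) s
      = Real.exp (ω ^ 2 * s) * ω ^ 2 := fun s => by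
    simpa using (((hasDerivAt_id s).const_mul (ω ^ 2)).exp).deriv
  simp only [hderiv, hx.initial_velocity, mul_zero, sub_zero] at h1
  have hfi : IntervalIntegrable f volume 0 t := by
    rw [intervalIntegrable_iff_integrableOn_Icc_of_le ht]
    exact hf.integrableOn_compact_subset Icc_subset_Ici_self isCompact_Icc
  have hef : IntervalIntegrable (fun s => Real.exp (ω ^ 2 * s) * f s) volume 0 t :=
    hfi.continuousOn_mul hexp.continuous.continuousOn
  have h2 : Real.exp (ω ^ 2 * t) * y₁ f ω t = ∫ s in (0 : ℝ)..t, Real.exp (ω ^ 2 * s) * f s := by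
    rw [y₁, ← intervalIntegral.integral_const_mul]
    refine intervalIntegral.integral_congr fun s _ => ?_
    rw [← mul_assoc, ← Real.exp_add]
    ring_nf
  have hi : IntervalIntegrable (fun s => Real.exp (ω ^ 2 * s) * ω ^ 2 * velocity x s
      + Real.exp (ω ^ 2 * s) * deriv (velocity x) s) volume 0 t := by
    refine (hvac.continuousOn.intervalIntegrable.continuousOn_mul ?_).add
      (hvac.intervalIntegrable_deriv.continuousOn_mul ?_)
    · exact (hexp.continuous.mul continuous_const).continuousOn
    · exact hexp.continuous.continuousOn
  rw [mul_sub, ← h1, h2, ← intervalIntegral.integral_sub hi hef]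
  refine intervalIntegral.integral_congr_ae ?_
  filter_upwards [(ae_restrict_iff' measurableSet_Ioi).1 hx.equation] with s hs hst
  rw [uIoc_of_le ht] at hst
  rw [← hs hst.1]
  ring

lemma velocity_sub_eq (hf : LocallyIntegrableOn f (Ici 0))
    (hx : IsRestSolution p f ω x) {t : ℝ} (ht : 0 ≤ t) :
    velocity x t - y₁ f ω t = Real.exp (-(ω ^ 2 * t)) * ∫ s in (0 : ℝ)..t,
        (ω ^ 2 * velocity x s - p s * velocity x s - ω ^ 2 * x s) * Real.exp (ω ^ 2 * s) := by
  rw [← hx.exp_mul_velocity_sub hf ht, ← mul_assoc, ← Real.exp_add, neg_add_cancel,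
    Real.exp_zero, one_mul]

lemma continuousOn_filtered (hp : IsAdmissibleDamping p) (hx : IsRestSolution p f ω x) :
    ContinuousOn (fun s => ω ^ 2 * velocity x s - p s * velocity x s - ω ^ 2 * x s) (Ici 0) :=
  ((continuousOn_const.mul hx.continuousOn_velocity).sub
    (hp.continuousOn.mul hx.continuousOn_velocity)).sub (continuousOn_const.mul hx.continuousOn)

lemma continuousOn_filtered_mul_exp (hp : IsAdmissibleDamping p) (hx : IsRestSolution p f ω x) :
    ContinuousOn (fun s => (ω ^ 2 * velocity x s - p s * velocity x s - ω ^ 2 * x s)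
      * Real.exp (ω ^ 2 * s)) (Ici 0) :=
  (hx.continuousOn_filtered hp).mul (by fun_prop)

/-- Continuity is read off from the solution: `y₁` is the velocity minus an expression in which `f`
no longer appears. -/
lemma continuousOn_y₁ (hp : IsAdmissibleDamping p) (hf : LocallyIntegrableOn f (Ici 0))
    (hx : IsRestSolution p f ω x) : ContinuousOn (y₁ f ω) (Ici 0) := by
  have h : ContinuousOn (fun t => velocity x t - Real.exp (-(ω ^ 2 * t)) * ∫ s in (0 : ℝ)..t,
      (ω ^ 2 * velocity x s - p s * velocity x s - ω ^ 2 * x s) * Real.exp (ω ^ 2 * s))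
      (Ici 0) :=
    hx.continuousOn_velocity.sub (ContinuousOn.mul (by fun_prop)
      (continuousOn_primitive (hx.continuousOn_filtered_mul_exp hp)))
  refine h.congr fun t ht => ?_
  simp only
  rw [← hx.velocity_sub_eq hf ht]
  ring

lemma hasDerivAt_velocity_sub (hp : IsAdmissibleDamping p) (hf : LocallyIntegrableOn f (Ici 0))
    (hx : IsRestSolution p f ω x) {t : ℝ} (ht : 0 < t) :
    HasDerivAt (fun t => velocity x t - y₁ f ω t)
      (ω ^ 2 * y₁ f ω t - p t * velocity x t - ω ^ 2 * x t) t := by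
  have h1 : HasDerivAt (fun t : ℝ => Real.exp (-(ω ^ 2 * t)))
      (Real.exp (-(ω ^ 2 * t)) * -(ω ^ 2)) t := by
    simpa using (((hasDerivAt_id t).const_mul (ω ^ 2)).neg).exp
  have h2 := h1.mul (hasDerivAt_primitive (hx.continuousOn_filtered_mul_exp hp) ht)
  have h3 := h2.congr_of_eventuallyEq (f₁ := fun t => velocity x t - y₁ f ω t) (by
    filter_upwards [Ioi_mem_nhds ht] with s hs
    exact hx.velocity_sub_eq hf (le_of_lt hs))
  refine h3.congr_deriv ?_
  have h4 : Real.exp (-(ω ^ 2 * t)) * Real.exp (ω ^ 2 * t) = 1 := by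
    rw [← Real.exp_add, neg_add_cancel, Real.exp_zero]
  linear_combination (ω ^ 2) * hx.velocity_sub_eq hf ht.le +
    (ω ^ 2 * velocity x t - p t * velocity x t - ω ^ 2 * x t) * h4

/-- The difference `x' - y₁` is an exponentially weighted average of `ω² x' - p x' - ω² x`, which
tends to zero because `p` is bounded by `p 0`. -/
lemma tendsto_y₁ (hω : ω ≠ 0) (hp : IsAdmissibleDamping p) (hf : LocallyIntegrableOn f (Ici 0))
    (hx : IsRestSolution p f ω x) (h0 : Tendsto x atTop (𝓝 0))
    (h1 : Tendsto (velocity x) atTop (𝓝 0)) : Tendsto (y₁ f ω) atTop (𝓝 0) := by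
  have hω2 : 0 < ω ^ 2 := by positivity
  have hpv : Tendsto (fun t => p t * velocity x t) atTop (𝓝 0) := by
    refine squeeze_zero_norm' (a := fun t => p 0 * |velocity x t|) ?_
      (by simpa using h1.abs.const_mul (p 0))
    filter_upwards [eventually_ge_atTop 0] with t ht
    rw [Real.norm_eq_abs, abs_mul, abs_of_pos (hp.pos t ht)]
    gcongr
    exact hp.le_initial ht
  have hg : Tendsto (fun s => ω ^ 2 * velocity x s - p s * velocity x s - ω ^ 2 * x s)
      atTop (𝓝 0) := by
    simpa using ((h1.const_mul (ω ^ 2)).sub hpv).sub (h0.const_mul (ω ^ 2))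
  have hexp : ∀ t : ℝ, HasDerivAt (fun t : ℝ => Real.exp (ω ^ 2 * t) / ω ^ 2)
      (Real.exp (ω ^ 2 * t)) t := fun t => by
    have h := ((((hasDerivAt_id t).const_mul (ω ^ 2)).exp).div_const (ω ^ 2))
    simp only [id, mul_one, mul_div_assoc, div_self hω2.ne'] at h
    exact h
  have ho := isLittleO_integral_of_tendsto_zero (b := fun s => Real.exp (ω ^ 2 * s))
    (a := fun t => Real.exp (ω ^ 2 * t) / ω ^ 2) (by fun_prop) (fun t _ => (Real.exp_pos _).le)
    (hx.continuousOn_filtered hp) hg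
    ((Real.tendsto_exp_atTop.comp (tendsto_id.const_mul_atTop hω2)).atTop_div_const hω2)
    (fun t ht => integral_eq_sub_of_hasDerivAt_Ioi (by fun_prop) (fun t _ => hexp t)
      (by fun_prop) ht)
  rw [isLittleO_iff_tendsto fun t ht => absurd ht (by positivity)] at ho
  have hv : Tendsto (fun t => velocity x t - y₁ f ω t) atTop (𝓝 0) := by
    have := ho.div_const (ω ^ 2)
    rw [zero_div] at this
    refine this.congr' ?_
    filter_upwards [eventually_ge_atTop 0] with t ht
    rw [← hx.exp_mul_velocity_sub hf ht]
    field_simp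
  simpa using h1.sub hv

end IsRestSolution

end Solution

/-! ### Rotating coordinates for the weighted solution. -/

section Rotating

variable {ω : ℝ} {p f x : ℝ → ℝ}

/-- The quasi-derivative of `A x`, corrected so that only the integrable perturbation remains. -/
noncomputable def weightedVelocity (p f : ℝ → ℝ) (ω : ℝ) (x : ℝ → ℝ) (t : ℝ) : ℝ :=
  A p t * (velocity x t - y₁ f ω t) + p t / 2 * (A p t * x t)

/-- First rotating coordinate of `(A x, weightedVelocity)`. -/
noncomputable def rotatingFst (p f : ℝ → ℝ) (ω : ℝ) (x : ℝ → ℝ) (t : ℝ) : ℝ :=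
  ω * Real.cos (ω * t) * (A p t * x t) - Real.sin (ω * t) * weightedVelocity p f ω x t

/-- Second rotating coordinate of `(A x, weightedVelocity)`. -/
noncomputable def rotatingSnd (p f : ℝ → ℝ) (ω : ℝ) (x : ℝ → ℝ) (t : ℝ) : ℝ :=
  ω * Real.sin (ω * t) * (A p t * x t) + Real.cos (ω * t) * weightedVelocity p f ω x t

/-- The response integral `∫₀ᵗ u(s) A(s) y₁(s) ds`. -/
noncomputable def response (p f : ℝ → ℝ) (ω : ℝ) (u : ℝ → ℝ) (t : ℝ) : ℝ :=
  ∫ s in (0 : ℝ)..t, u s * A p s * y₁ f ω s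

/-- The damping correction `∫₀ᵗ u y₁ dA`. -/
noncomputable def dampingCorrection (p f : ℝ → ℝ) (ω : ℝ) (u : ℝ → ℝ) (t : ℝ) : ℝ :=
  ∫ s in (0 : ℝ)..t, u s * y₁ f ω s * (p s / 2 * A p s)

/-- The correction `∫₀ᵗ u(s) q(s) A(s) x(s) ds` coming from the perturbation `q`. -/
noncomputable def perturbationCorrection (p x u : ℝ → ℝ) (t : ℝ) : ℝ :=
  ∫ s in (0 : ℝ)..t, u s * (perturbation p s * (A p s * x s))

namespace IsRestSolution

lemma continuousOn_weightedVelocity (hp : IsAdmissibleDamping p)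
    (hf : LocallyIntegrableOn f (Ici 0)) (hx : IsRestSolution p f ω x) :
    ContinuousOn (weightedVelocity p f ω x) (Ici 0) :=
  ((continuousOn_A hp).mul (hx.continuousOn_velocity.sub (hx.continuousOn_y₁ hp hf))).add
    ((hp.continuousOn.div_const 2).mul ((continuousOn_A hp).mul hx.continuousOn))

lemma hasDerivAt_A_mul (hp : IsAdmissibleDamping p) (hx : IsRestSolution p f ω x) {t : ℝ}
    (ht : 0 < t) : HasDerivAt (fun t => A p t * x t)
      (weightedVelocity p f ω x t + A p t * y₁ f ω t) t := by
  refine ((hasDerivAt_A hp ht).mul (hx.hasDerivAt ht)).congr_deriv ?_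
  rw [weightedVelocity]
  ring

/-- The velocity terms carry the coefficients `p/2`, `-p` and `p/2` and cancel; the leftovers `p'/2`
and `p²/4` form the perturbation. -/
lemma hasDerivAt_weightedVelocity (hp : IsAdmissibleDamping p)
    (hf : LocallyIntegrableOn f (Ici 0)) (hx : IsRestSolution p f ω x) {t : ℝ} (ht : 0 < t) :
    HasDerivAt (weightedVelocity p f ω x)
      (-ω ^ 2 * (A p t * x t) + perturbation p t * (A p t * x t) + ω ^ 2 * (A p t * y₁ f ω t)
        - y₁ f ω t * (p t / 2 * A p t)) t := by
  refine (((hasDerivAt_A hp ht).mul (hx.hasDerivAt_velocity_sub hp hf ht)).add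
    (((hp.hasDerivAt ht).div_const 2).mul (hx.hasDerivAt_A_mul hp ht))).congr_deriv ?_
  rw [weightedVelocity, perturbation]
  ring

lemma continuousOn_response_integrand (hp : IsAdmissibleDamping p)
    (hf : LocallyIntegrableOn f (Ici 0)) (hx : IsRestSolution p f ω x) {u : ℝ → ℝ}
    (hu : Continuous u) : ContinuousOn (fun s => u s * A p s * y₁ f ω s) (Ici 0) :=
  (hu.continuousOn.mul (continuousOn_A hp)).mul (hx.continuousOn_y₁ hp hf)

lemma continuousOn_dampingCorrection_integrand (hp : IsAdmissibleDamping p)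
    (hf : LocallyIntegrableOn f (Ici 0)) (hx : IsRestSolution p f ω x) {u : ℝ → ℝ}
    (hu : Continuous u) : ContinuousOn (fun s => u s * y₁ f ω s * (p s / 2 * A p s)) (Ici 0) :=
  (hu.continuousOn.mul (hx.continuousOn_y₁ hp hf)).mul
    ((hp.continuousOn.div_const 2).mul (continuousOn_A hp))

lemma continuousOn_perturbationCorrection_integrand (hp : IsAdmissibleDamping p)
    (hx : IsRestSolution p f ω x) {u : ℝ → ℝ} (hu : Continuous u) :
    ContinuousOn (fun s => u s * (perturbation p s * (A p s * x s))) (Ici 0) :=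
  hu.continuousOn.mul
    ((continuousOn_perturbation hp).mul ((continuousOn_A hp).mul hx.continuousOn))

/-- A linear combination of the three kinds of integrals is the integral of the combination. -/
lemma integral_combination (hp : IsAdmissibleDamping p) (hf : LocallyIntegrableOn f (Ici 0))
    (hx : IsRestSolution p f ω x) {u v w z : ℝ → ℝ} (hu : Continuous u) (hv : Continuous v)
    (hw : Continuous w) (hz : Continuous z) (c d : ℝ) {t : ℝ} (ht : 0 ≤ t) :
    ∫ s in (0 : ℝ)..t, (c * (u s * A p s * y₁ f ω s) + d * (v s * A p s * y₁ f ω s)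
        + w s * (perturbation p s * (A p s * x s)) - z s * y₁ f ω s * (p s / 2 * A p s))
      = c * response p f ω u t + d * response p f ω v t + perturbationCorrection p x w t
        - dampingCorrection p f ω z t := by
  have hi {g : ℝ → ℝ} (hg : ContinuousOn g (Ici 0)) : IntervalIntegrable g volume 0 t :=
    intervalIntegrable_of_continuousOn_Ici hg le_rfl ht
  have h1 := (hi (hx.continuousOn_response_integrand hp hf hu)).const_mul c
  have h2 := (hi (hx.continuousOn_response_integrand hp hf hv)).const_mul d
  have h3 := hi (hx.continuousOn_perturbationCorrection_integrand hp hw)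
  have h4 := hi (hx.continuousOn_dampingCorrection_integrand hp hf hz)
  rw [intervalIntegral.integral_sub ((h1.add h2).add h3) h4,
    intervalIntegral.integral_add (h1.add h2) h3, intervalIntegral.integral_add h1 h2,
    intervalIntegral.integral_const_mul, intervalIntegral.integral_const_mul]
  rfl

lemma continuousOn_combination (hp : IsAdmissibleDamping p) (hf : LocallyIntegrableOn f (Ici 0))
    (hx : IsRestSolution p f ω x) {u v w z : ℝ → ℝ} (hu : Continuous u) (hv : Continuous v)
    (hw : Continuous w) (hz : Continuous z) (c d : ℝ) :
    ContinuousOn (fun s => c * (u s * A p s * y₁ f ω s) + d * (v s * A p s * y₁ f ω s)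
        + w s * (perturbation p s * (A p s * x s)) - z s * y₁ f ω s * (p s / 2 * A p s)) (Ici 0) :=
  (((continuousOn_const.mul (hx.continuousOn_response_integrand hp hf hu)).add
    (continuousOn_const.mul (hx.continuousOn_response_integrand hp hf hv))).add
    (hx.continuousOn_perturbationCorrection_integrand hp hw)).sub
    (hx.continuousOn_dampingCorrection_integrand hp hf hz)

lemma weightedVelocity_zero (hx : IsRestSolution p f ω x) : weightedVelocity p f ω x 0 = 0 := by
  simp [weightedVelocity, hx.initial_position, hx.initial_velocity, y₁]

lemma hasDerivAt_cos_mul (ω t : ℝ) :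
    HasDerivAt (fun t => Real.cos (ω * t)) (-Real.sin (ω * t) * ω) t := by
  simpa using ((hasDerivAt_id t).const_mul ω).cos

lemma hasDerivAt_sin_mul (ω t : ℝ) :
    HasDerivAt (fun t => Real.sin (ω * t)) (Real.cos (ω * t) * ω) t := by
  simpa using ((hasDerivAt_id t).const_mul ω).sin

/-- Differentiating cancels the pure oscillation terms, and the rest data make the initial value
zero. -/
lemma rotatingFst_eq (hp : IsAdmissibleDamping p) (hf : LocallyIntegrableOn f (Ici 0))
    (hx : IsRestSolution p f ω x) {t : ℝ} (ht : 0 ≤ t) :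
    rotatingFst p f ω x t = ω * response p f ω (fun s => Real.cos (ω * s)) t
      + -ω ^ 2 * response p f ω (fun s => Real.sin (ω * s)) t
      + perturbationCorrection p x (fun s => -Real.sin (ω * s)) t
      - dampingCorrection p f ω (fun s => -Real.sin (ω * s)) t := by
  have hcont : ContinuousOn (rotatingFst p f ω x) (Ici 0) :=
    (ContinuousOn.mul (by fun_prop) ((continuousOn_A hp).mul hx.continuousOn)).sub
      (ContinuousOn.mul (by fun_prop) (hx.continuousOn_weightedVelocity hp hf))
  rw [← hx.integral_combination hp hf (by fun_prop) (by fun_prop) (by fun_prop) (by fun_prop) _ _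
    ht, integral_eq_sub_of_hasDerivAt_Ioi hcont (fun s hs => ?_)
    (hx.continuousOn_combination hp hf (by fun_prop) (by fun_prop) (by fun_prop) (by fun_prop) _ _)
    ht]
  · simp [rotatingFst, hx.initial_position, hx.weightedVelocity_zero]
  · refine ((((hasDerivAt_cos_mul ω s).const_mul ω).mul (hx.hasDerivAt_A_mul hp hs)).sub
      ((hasDerivAt_sin_mul ω s).mul (hx.hasDerivAt_weightedVelocity hp hf hs))).congr_deriv ?_
    ring

lemma rotatingSnd_eq (hp : IsAdmissibleDamping p) (hf : LocallyIntegrableOn f (Ici 0))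
    (hx : IsRestSolution p f ω x) {t : ℝ} (ht : 0 ≤ t) :
    rotatingSnd p f ω x t = ω * response p f ω (fun s => Real.sin (ω * s)) t
      + ω ^ 2 * response p f ω (fun s => Real.cos (ω * s)) t
      + perturbationCorrection p x (fun s => Real.cos (ω * s)) t
      - dampingCorrection p f ω (fun s => Real.cos (ω * s)) t := by
  have hcont : ContinuousOn (rotatingSnd p f ω x) (Ici 0) :=
    (ContinuousOn.mul (by fun_prop) ((continuousOn_A hp).mul hx.continuousOn)).add
      (ContinuousOn.mul (by fun_prop) (hx.continuousOn_weightedVelocity hp hf))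
  rw [← hx.integral_combination hp hf (by fun_prop) (by fun_prop) (by fun_prop) (by fun_prop) _ _
    ht, integral_eq_sub_of_hasDerivAt_Ioi hcont (fun s hs => ?_)
    (hx.continuousOn_combination hp hf (by fun_prop) (by fun_prop) (by fun_prop) (by fun_prop) _ _)
    ht]
  · simp [rotatingSnd, hx.initial_position, hx.weightedVelocity_zero]
  · refine ((((hasDerivAt_sin_mul ω s).const_mul ω).mul (hx.hasDerivAt_A_mul hp hs)).add
      ((hasDerivAt_cos_mul ω s).mul (hx.hasDerivAt_weightedVelocity hp hf hs))).congr_deriv ?_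
    ring

lemma isLittleO_dampingCorrection (hp : IsAdmissibleDamping p)
    (hf : LocallyIntegrableOn f (Ici 0)) (hx : IsRestSolution p f ω x)
    (hy : Tendsto (y₁ f ω) atTop (𝓝 0)) {u : ℝ → ℝ} (hu : Continuous u)
    (hu1 : ∀ t, |u t| ≤ 1) : dampingCorrection p f ω u =o[atTop] A p := by
  refine isLittleO_integral_of_tendsto_zero (b := fun s => p s / 2 * A p s)
    (g := fun s => u s * y₁ f ω s)
    ((hp.continuousOn.div_const 2).mul (continuousOn_A hp))
    (fun t ht => mul_nonneg (by linarith [hp.pos t ht]) (A_pos p t).le)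
    (hu.continuousOn.mul (hx.continuousOn_y₁ hp hf)) ?_ (tendsto_A hp)
    (fun t ht => integral_eq_sub_of_hasDerivAt_Ioi (continuousOn_A hp)
      (fun s hs => hasDerivAt_A hp hs) ((hp.continuousOn.div_const 2).mul (continuousOn_A hp)) ht)
  refine squeeze_zero_norm (a := fun t => |y₁ f ω t|) (fun t => ?_) (by simpa using hy.abs)
  rw [Real.norm_eq_abs, abs_mul]
  exact mul_le_of_le_one_left (abs_nonneg _) (hu1 t)

lemma isLittleO_perturbationCorrection (hp : IsAdmissibleDamping p)
    (hx : IsRestSolution p f ω x) {M : ℝ} (hM : ∀ t, 0 ≤ t → |x t| ≤ M) {u : ℝ → ℝ}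
    (hu : Continuous u) (hu1 : ∀ t, |u t| ≤ 1) :
    perturbationCorrection p x u =o[atTop] A p := by
  have hM0 : 0 ≤ M := (abs_nonneg _).trans (hM 0 le_rfl)
  refine isLittleO_integral_of_le_integrable_mul (k := fun s => |perturbation p s| * M)
    ((continuousOn_perturbation hp).abs.mul continuousOn_const)
    ((integrableOn_perturbation hp).abs.mul_const _) (fun t _ => by positivity) (tendsto_A hp)
    (monotoneOn_A hp) (fun t _ => (A_pos p t).le)
    (hx.continuousOn_perturbationCorrection_integrand hp hu) fun t ht => ?_
  rw [abs_mul, abs_mul, abs_mul, abs_of_pos (A_pos p t)]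
  calc |u t| * (|perturbation p t| * (A p t * |x t|))
      ≤ 1 * (|perturbation p t| * (A p t * M)) := by
        have := (A_pos p t).le
        gcongr
        · exact hu1 t
        · exact hM t ht
    _ = |perturbation p t| * M * A p t := by ring

lemma abs_perturbationCorrection_le (hp : IsAdmissibleDamping p) (hx : IsRestSolution p f ω x)
    {u : ℝ → ℝ} (hu1 : ∀ t, |u t| ≤ 1) {t : ℝ} (ht : 0 ≤ t) :
    |perturbationCorrection p x u t| ≤
      (∫ s in (0 : ℝ)..t, |perturbation p s| * |x s|) * A p t := by
  rw [← intervalIntegral.integral_mul_const]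
  refine abs_integral_le (((continuousOn_perturbation hp).abs.mul hx.continuousOn.abs).mul
    continuousOn_const) le_rfl ht fun s hs hst => ?_
  have h1 := monotoneOn_A hp hs ht hst
  have h2 := (A_pos p s).le
  rw [abs_mul, abs_mul, abs_mul, abs_of_pos (A_pos p s)]
  calc |u s| * (|perturbation p s| * (A p s * |x s|))
      ≤ 1 * (|perturbation p s| * (A p t * |x s|)) := by
        gcongr
        exact hu1 s
    _ = |perturbation p s| * |x s| * A p t := by ring

lemma A_mul_eq (hω : ω ≠ 0) (t : ℝ) : A p t * x t = Real.cos (ω * t) / ω * rotatingFst p f ω x t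
    + Real.sin (ω * t) / ω * rotatingSnd p f ω x t := by
  rw [rotatingFst, rotatingSnd]
  field_simp
  linear_combination (-(A p t * x t * ω)) * Real.sin_sq_add_cos_sq (ω * t)

lemma weightedVelocity_eq (t : ℝ) : weightedVelocity p f ω x t =
    -Real.sin (ω * t) * rotatingFst p f ω x t + Real.cos (ω * t) * rotatingSnd p f ω x t := by
  rw [rotatingFst, rotatingSnd]
  linear_combination (-weightedVelocity p f ω x t) * Real.sin_sq_add_cos_sq (ω * t)

/-- The response and damping terms are `O(A)`, and the perturbation term is at most `A(t) ∫ |q|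
|x|`. Dividing by `A(t)` leaves a Gronwall inequality for `|x|` with integrable kernel. -/
lemma exists_bound_of_isLittleO_response (hω : ω ≠ 0) (hp : IsAdmissibleDamping p)
    (hf : LocallyIntegrableOn f (Ici 0)) (hx : IsRestSolution p f ω x)
    (hy : Tendsto (y₁ f ω) atTop (𝓝 0))
    (hC : response p f ω (fun s => Real.cos (ω * s)) =o[atTop] A p)
    (hS : response p f ω (fun s => Real.sin (ω * s)) =o[atTop] A p) :
    ∃ M, ∀ t, 0 ≤ t → |x t| ≤ M := by
  have hresp {u : ℝ → ℝ} (hu : Continuous u) : ContinuousOn (response p f ω u) (Ici 0) :=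
    continuousOn_primitive (hx.continuousOn_response_integrand hp hf hu)
  have hdamp {u : ℝ → ℝ} (hu : Continuous u) : ContinuousOn (dampingCorrection p f ω u) (Ici 0) :=
    continuousOn_primitive (hx.continuousOn_dampingCorrection_integrand hp hf hu)
  have hsin1 : ∀ t, |-Real.sin (ω * t)| ≤ 1 := fun t => by
    rw [abs_neg]; exact Real.abs_sin_le_one _
  have hcos1 : ∀ t, |Real.cos (ω * t)| ≤ 1 := fun t => Real.abs_cos_le_one _
  obtain ⟨c, -, hc⟩ := exists_bound_of_isBigO_of_continuousOn
    (((continuousOn_const.mul (hresp (u := fun s => Real.cos (ω * s)) (by fun_prop))).add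
      (continuousOn_const.mul (hresp (u := fun s => Real.sin (ω * s)) (by fun_prop)))).sub
      (hdamp (u := fun s => -Real.sin (ω * s)) (by fun_prop))) (fun t => one_le_A hp)
    (((hC.const_mul_left ω).add (hS.const_mul_left (-ω ^ 2))).sub
      (hx.isLittleO_dampingCorrection hp hf hy (by fun_prop) hsin1)).isBigO
  obtain ⟨d, -, hd⟩ := exists_bound_of_isBigO_of_continuousOn
    (((continuousOn_const.mul (hresp (u := fun s => Real.sin (ω * s)) (by fun_prop))).add
      (continuousOn_const.mul (hresp (u := fun s => Real.cos (ω * s)) (by fun_prop)))).sub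
      (hdamp (u := fun s => Real.cos (ω * s)) (by fun_prop))) (fun t => one_le_A hp)
    (((hS.const_mul_left ω).add (hC.const_mul_left (ω ^ 2))).sub
      (hx.isLittleO_dampingCorrection hp hf hy (by fun_prop) hcos1)).isBigO
  -- Both rotating coordinates contribute the same perturbation integral, hence the factor `2`;
  -- recovering `A x` from them costs the division by `|ω|`.
  refine exists_bound_of_le_const_add_integral (m := fun t => |x t|) (K := (c + d) / |ω|)
    (k := fun t => |perturbation p t| * (2 / |ω|))
    ((continuousOn_perturbation hp).abs.mul continuousOn_const)
    ((integrableOn_perturbation hp).abs.mul_const _) (fun t _ => by positivity)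
    hx.continuousOn.abs (fun t _ => abs_nonneg _) fun t ht => ?_
  have hJ : ∫ s in (0 : ℝ)..t, |perturbation p s| * (2 / |ω|) * |x s|
      = 2 / |ω| * ∫ s in (0 : ℝ)..t, |perturbation p s| * |x s| := by
    rw [← intervalIntegral.integral_const_mul]
    exact intervalIntegral.integral_congr fun s _ => by ring
  rw [hJ]
  set J := ∫ s in (0 : ℝ)..t, |perturbation p s| * |x s|
  have hω' : 0 < |ω| := abs_pos.2 hω
  have hA := A_pos p t
  have h1 : |rotatingFst p f ω x t| ≤ (c + J) * A p t := by
    rw [hx.rotatingFst_eq hp hf ht, add_sub_right_comm]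
    exact (abs_add_le _ _).trans ((add_le_add (hc t ht)
      (hx.abs_perturbationCorrection_le hp hsin1 ht)).trans_eq (add_mul _ _ _).symm)
  have h2 : |rotatingSnd p f ω x t| ≤ (d + J) * A p t := by
    rw [hx.rotatingSnd_eq hp hf ht, add_sub_right_comm]
    exact (abs_add_le _ _).trans ((add_le_add (hd t ht)
      (hx.abs_perturbationCorrection_le hp hcos1 ht)).trans_eq (add_mul _ _ _).symm)
  have h3 : A p t * |x t| * |ω| ≤ (c + J) * A p t + (d + J) * A p t := by
    have h4 : A p t * x t * ω = Real.cos (ω * t) * rotatingFst p f ω x t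
        + Real.sin (ω * t) * rotatingSnd p f ω x t := by
      rw [A_mul_eq (f := f) hω]
      field_simp
    have h5 : A p t * |x t| * |ω| = |A p t * x t * ω| := by
      rw [abs_mul, abs_mul, abs_of_pos hA]
    rw [h5, h4]
    refine (abs_add_le _ _).trans (add_le_add ?_ ?_)
    · rw [abs_mul]
      exact (mul_le_of_le_one_left (abs_nonneg _) (Real.abs_cos_le_one _)).trans h1
    · rw [abs_mul]
      exact (mul_le_of_le_one_left (abs_nonneg _) (Real.abs_sin_le_one _)).trans h2
  have h6 : |x t| * |ω| ≤ c + d + 2 * J := by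
    refine le_of_mul_le_mul_left ?_ hA
    linarith
  have h7 : (c + d) / |ω| + 2 / |ω| * J = (c + d + 2 * J) / |ω| := by ring
  rw [h7, le_div_iff₀ hω']
  exact h6

end IsRestSolution

end Rotating

/-! ### The equivalences between decay, response integrals and kernel integrals. -/

section Equivalence

variable {ω : ℝ} {p f x : ℝ → ℝ}

namespace IsRestSolution

lemma isLittleO_rotating_iff (hω : ω ≠ 0) (hp : IsAdmissibleDamping p)
    (hf : LocallyIntegrableOn f (Ici 0)) (hx : IsRestSolution p f ω x)
    (hy : Tendsto (y₁ f ω) atTop (𝓝 0)) {M : ℝ} (hM : ∀ t, 0 ≤ t → |x t| ≤ M) :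
    (response p f ω (fun s => Real.cos (ω * s)) =o[atTop] A p ∧
      response p f ω (fun s => Real.sin (ω * s)) =o[atTop] A p) ↔
    (rotatingFst p f ω x =o[atTop] A p ∧ rotatingSnd p f ω x =o[atTop] A p) := by
  have hsin1 : ∀ t, |-Real.sin (ω * t)| ≤ 1 := fun t => by
    rw [abs_neg]; exact Real.abs_sin_le_one _
  have hcos1 : ∀ t, |Real.cos (ω * t)| ≤ 1 := fun t => Real.abs_cos_le_one _
  have hfst := (hx.isLittleO_perturbationCorrection hp hM (by fun_prop) hsin1).sub
    (hx.isLittleO_dampingCorrection hp hf hy (by fun_prop) hsin1)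
  have hsnd := (hx.isLittleO_perturbationCorrection hp hM (by fun_prop) hcos1).sub
    (hx.isLittleO_dampingCorrection hp hf hy (by fun_prop) hcos1)
  have hconst (c : ℝ) : ∃ d, ∀ _ : ℝ, |c| ≤ d := ⟨|c|, fun _ => le_rfl⟩
  set C := response p f ω (fun s => Real.cos (ω * s))
  set S := response p f ω (fun s => Real.sin (ω * s))
  -- The constant matrix with rows `(ω, -ω²)` and `(ω², ω)` has determinant `ω² + ω⁴ ≠ 0`; the
  -- primed coefficients are its inverse.
  have h1 : (C =o[atTop] A p ∧ S =o[atTop] A p) ↔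
      ((fun t => ω * C t + -ω ^ 2 * S t) =o[atTop] A p ∧
        (fun t => ω ^ 2 * C t + ω * S t) =o[atTop] A p) :=
    isLittleO_pair_congr (α := fun _ => ω) (β := fun _ => -ω ^ 2) (γ := fun _ => ω ^ 2)
      (δ := fun _ => ω) (α' := fun _ => ω / (ω ^ 2 + ω ^ 4)) (β' := fun _ => ω ^ 2 / (ω ^ 2 + ω ^ 4))
      (γ' := fun _ => -ω ^ 2 / (ω ^ 2 + ω ^ 4)) (δ' := fun _ => ω / (ω ^ 2 + ω ^ 4))
      (.of_forall fun _ => rfl) (.of_forall fun _ => rfl)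
      (.of_forall fun t => by
        have : ω ^ 2 + ω ^ 4 ≠ 0 := by positivity
        field_simp
        ring)
      (.of_forall fun t => by
        have : ω ^ 2 + ω ^ 4 ≠ 0 := by positivity
        field_simp
        ring)
      (hconst _) (hconst _) (hconst _) (hconst _) (hconst _) (hconst _) (hconst _) (hconst _)
  rw [h1]
  have h2 : (fun t => ω * C t + -ω ^ 2 * S t) =o[atTop] A p ↔
      rotatingFst p f ω x =o[atTop] A p := by
    rw [← hfst.add_iff_left]
    refine isLittleO_congr ?_ .rfl
    filter_upwards [eventually_ge_atTop 0] with t ht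
    rw [hx.rotatingFst_eq hp hf ht]
    ring
  have h3 : (fun t => ω ^ 2 * C t + ω * S t) =o[atTop] A p ↔
      rotatingSnd p f ω x =o[atTop] A p := by
    rw [← hsnd.add_iff_left]
    refine isLittleO_congr ?_ .rfl
    filter_upwards [eventually_ge_atTop 0] with t ht
    rw [hx.rotatingSnd_eq hp hf ht]
    ring
  rw [h2, h3]

lemma isLittleO_rotating_iff_tendsto (hω : ω ≠ 0) (hp : IsAdmissibleDamping p)
    (hy : Tendsto (y₁ f ω) atTop (𝓝 0)) :
    (rotatingFst p f ω x =o[atTop] A p ∧ rotatingSnd p f ω x =o[atTop] A p) ↔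
    (Tendsto x atTop (𝓝 0) ∧ Tendsto (velocity x) atTop (𝓝 0)) := by
  have h1 : (rotatingFst p f ω x =o[atTop] A p ∧ rotatingSnd p f ω x =o[atTop] A p) ↔
      ((fun t => A p t * x t) =o[atTop] A p ∧ weightedVelocity p f ω x =o[atTop] A p) :=
    isLittleO_pair_congr
      (α := fun t => 1 / ω * Real.cos (ω * t) + 0 * Real.sin (ω * t))
      (β := fun t => 0 * Real.cos (ω * t) + 1 / ω * Real.sin (ω * t))
      (γ := fun t => 0 * Real.cos (ω * t) + -1 * Real.sin (ω * t))
      (δ := fun t => 1 * Real.cos (ω * t) + 0 * Real.sin (ω * t))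
      (α' := fun t => ω * Real.cos (ω * t) + 0 * Real.sin (ω * t))
      (β' := fun t => 0 * Real.cos (ω * t) + -1 * Real.sin (ω * t))
      (γ' := fun t => 0 * Real.cos (ω * t) + ω * Real.sin (ω * t))
      (δ' := fun t => 1 * Real.cos (ω * t) + 0 * Real.sin (ω * t))
      (.of_forall fun t => by rw [A_mul_eq (f := f) hω]; ring)
      (.of_forall fun t => by rw [weightedVelocity_eq]; ring)
      (.of_forall fun t => by rw [rotatingFst]; ring)
      (.of_forall fun t => by rw [rotatingSnd]; ring)
      (exists_bound_trigonometric _ _ _) (exists_bound_trigonometric _ _ _)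
      (exists_bound_trigonometric _ _ _) (exists_bound_trigonometric _ _ _)
      (exists_bound_trigonometric _ _ _) (exists_bound_trigonometric _ _ _)
      (exists_bound_trigonometric _ _ _) (exists_bound_trigonometric _ _ _)
  rw [h1, isLittleO_A_iff (u := x) (fun _ _ => rfl),
    isLittleO_A_iff (u := fun t => velocity x t - y₁ f ω t + p t / 2 * x t)
      (fun t _ => by rw [weightedVelocity]; ring)]
  -- Having `x → 0` at hand in both directions makes the extra term `(p/2) x` vanish, as `p` is
  -- bounded.
  refine and_congr_right fun h0 => ?_
  have hpx : Tendsto (fun t => p t / 2 * x t) atTop (𝓝 0) := by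
    refine squeeze_zero_norm' (a := fun t => p 0 / 2 * |x t|) ?_
      (by simpa using h0.abs.const_mul (p 0 / 2))
    filter_upwards [eventually_ge_atTop 0] with t ht
    have := hp.pos t ht
    rw [Real.norm_eq_abs, abs_mul, abs_of_pos (by positivity)]
    have := hp.le_initial ht
    gcongr
  constructor
  · intro h
    simpa using (h.sub hpx).add hy
  · intro h
    simpa using (h.sub hy).add hpx

/-- The comparison with rotating coordinates needs `x` bounded; each direction supplies this
differently, by Gronwall or from convergence and continuity. -/
lemma isLittleO_response_iff (hω : ω ≠ 0) (hp : IsAdmissibleDamping p)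
    (hf : LocallyIntegrableOn f (Ici 0)) (hx : IsRestSolution p f ω x)
    (hy : Tendsto (y₁ f ω) atTop (𝓝 0)) :
    (response p f ω (fun s => Real.cos (ω * s)) =o[atTop] A p ∧
      response p f ω (fun s => Real.sin (ω * s)) =o[atTop] A p) ↔
    (Tendsto x atTop (𝓝 0) ∧ Tendsto (velocity x) atTop (𝓝 0)) := by
  rw [← isLittleO_rotating_iff_tendsto hω hp hy]
  constructor
  · intro h
    obtain ⟨M, hM⟩ := hx.exists_bound_of_isLittleO_response hω hp hf hy h.1 h.2
    exact (hx.isLittleO_rotating_iff hω hp hf hy hM).1 h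
  · intro h
    have h0 := ((isLittleO_rotating_iff_tendsto hω hp hy).1 h).1
    obtain ⟨M, -, hM⟩ := exists_bound_of_isBigO_of_continuousOn (a := fun _ => 1)
      hx.continuousOn (fun _ _ => le_rfl) (h0.isBigO_one ℝ)
    exact (hx.isLittleO_rotating_iff hω hp hf hy (M := M)
      fun t ht => by simpa using hM t ht).2 h

lemma A_mul_integral_L₁ (hp : IsAdmissibleDamping p) (hf : LocallyIntegrableOn f (Ici 0))
    (hx : IsRestSolution p f ω x) {t : ℝ} (ht : 0 ≤ t) :
    A p t * ∫ s in (0 : ℝ)..t, E p t s * L₁ ω t s * y₁ f ω s =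
      (1 * Real.cos (ω * t) + ω * Real.sin (ω * t)) * response p f ω (fun s => Real.cos (ω * s)) t
      + (-ω * Real.cos (ω * t) + 1 * Real.sin (ω * t))
        * response p f ω (fun s => Real.sin (ω * s)) t := by
  have hi {u : ℝ → ℝ} (hu : Continuous u) :=
    intervalIntegrable_of_continuousOn_Ici (hx.continuousOn_response_integrand hp hf hu) le_rfl ht
  rw [response, response, ← intervalIntegral.integral_const_mul,
    ← intervalIntegral.integral_const_mul, ← intervalIntegral.integral_const_mul,
    ← intervalIntegral.integral_add ((hi (by fun_prop)).const_mul _)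
      ((hi (by fun_prop)).const_mul _)]
  refine intervalIntegral.integral_congr fun s hs => ?_
  rw [uIcc_of_le ht] at hs
  simp only [L₁, ← E_mul_A hp hs.1 ht, mul_sub, Real.sin_sub, Real.cos_sub]
  ring

lemma A_mul_integral_L₂ (hp : IsAdmissibleDamping p) (hf : LocallyIntegrableOn f (Ici 0))
    (hx : IsRestSolution p f ω x) {t : ℝ} (ht : 0 ≤ t) :
    A p t * ∫ s in (0 : ℝ)..t, E p t s * L₂ ω t s * y₁ f ω s =
      (ω ^ 2 * Real.cos (ω * t) + -ω * Real.sin (ω * t))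
        * response p f ω (fun s => Real.cos (ω * s)) t
      + (ω * Real.cos (ω * t) + ω ^ 2 * Real.sin (ω * t))
        * response p f ω (fun s => Real.sin (ω * s)) t := by
  have hi {u : ℝ → ℝ} (hu : Continuous u) :=
    intervalIntegrable_of_continuousOn_Ici (hx.continuousOn_response_integrand hp hf hu) le_rfl ht
  rw [response, response, ← intervalIntegral.integral_const_mul,
    ← intervalIntegral.integral_const_mul, ← intervalIntegral.integral_const_mul,
    ← intervalIntegral.integral_add ((hi (by fun_prop)).const_mul _)
      ((hi (by fun_prop)).const_mul _)]
  refine intervalIntegral.integral_congr fun s hs => ?_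
  rw [uIcc_of_le ht] at hs
  simp only [L₂, ← E_mul_A hp hs.1 ht, mul_sub, Real.sin_sub, Real.cos_sub]
  ring

lemma isLittleO_response_iff_tendsto_kernel (hω : ω ≠ 0) (hp : IsAdmissibleDamping p)
    (hf : LocallyIntegrableOn f (Ici 0)) (hx : IsRestSolution p f ω x) :
    (response p f ω (fun s => Real.cos (ω * s)) =o[atTop] A p ∧
      response p f ω (fun s => Real.sin (ω * s)) =o[atTop] A p) ↔
    (Tendsto (fun t => ∫ s in (0 : ℝ)..t, E p t s * L₁ ω t s * y₁ f ω s) atTop (𝓝 0) ∧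
      Tendsto (fun t => ∫ s in (0 : ℝ)..t, E p t s * L₂ ω t s * y₁ f ω s) atTop (𝓝 0)) := by
  rw [← isLittleO_A_iff (p := p)
      (u := fun t => ∫ s in (0 : ℝ)..t, E p t s * L₁ ω t s * y₁ f ω s) fun _ _ => rfl,
    ← isLittleO_A_iff (p := p)
      (u := fun t => ∫ s in (0 : ℝ)..t, E p t s * L₂ ω t s * y₁ f ω s) fun _ _ => rfl]
  have hD : 1 + ω ^ 2 ≠ 0 := by positivity
  -- The rotating coefficient matrix has determinant `ω ((cos + ω sin)² + (sin - ω cos)²) = ω (1 +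
  -- ω²)`, independent of `t`, so the entries of its inverse are bounded too.
  refine isLittleO_pair_congr
    (α := fun t => 1 * Real.cos (ω * t) + ω * Real.sin (ω * t))
    (β := fun t => -ω * Real.cos (ω * t) + 1 * Real.sin (ω * t))
    (γ := fun t => ω ^ 2 * Real.cos (ω * t) + -ω * Real.sin (ω * t))
    (δ := fun t => ω * Real.cos (ω * t) + ω ^ 2 * Real.sin (ω * t))
    (α' := fun t => 1 / (1 + ω ^ 2) * Real.cos (ω * t) + ω / (1 + ω ^ 2) * Real.sin (ω * t))
    (β' := fun t => 1 / (1 + ω ^ 2) * Real.cos (ω * t)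
      + -1 / (ω * (1 + ω ^ 2)) * Real.sin (ω * t))
    (γ' := fun t => -ω / (1 + ω ^ 2) * Real.cos (ω * t) + 1 / (1 + ω ^ 2) * Real.sin (ω * t))
    (δ' := fun t => 1 / (ω * (1 + ω ^ 2)) * Real.cos (ω * t)
      + 1 / (1 + ω ^ 2) * Real.sin (ω * t))
    ?_ ?_ ?_ ?_
    (exists_bound_trigonometric _ _ _) (exists_bound_trigonometric _ _ _)
    (exists_bound_trigonometric _ _ _) (exists_bound_trigonometric _ _ _)
    (exists_bound_trigonometric _ _ _) (exists_bound_trigonometric _ _ _)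
    (exists_bound_trigonometric _ _ _) (exists_bound_trigonometric _ _ _)
  · filter_upwards [eventually_ge_atTop 0] with t ht using hx.A_mul_integral_L₁ hp hf ht
  · filter_upwards [eventually_ge_atTop 0] with t ht using hx.A_mul_integral_L₂ hp hf ht
  · filter_upwards [eventually_ge_atTop 0] with t ht
    rw [hx.A_mul_integral_L₁ hp hf ht, hx.A_mul_integral_L₂ hp hf ht]
    field_simp
    linear_combination (-(1 + ω ^ 2) * response p f ω (fun s => Real.cos (ω * s)) t)
      * Real.sin_sq_add_cos_sq (ω * t)
  · filter_upwards [eventually_ge_atTop 0] with t ht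
    rw [hx.A_mul_integral_L₁ hp hf ht, hx.A_mul_integral_L₂ hp hf ht]
    field_simp
    linear_combination (-(1 + ω ^ 2) * response p f ω (fun s => Real.sin (ω * s)) t)
      * Real.sin_sq_add_cos_sq (ω * t)

end IsRestSolution

end Equivalence

end DampedOscillator

theorem mainTheorem2 (ω : ℝ) (hω : ω ≠ 0) (p f x : ℝ → ℝ)
    (hp : DampedOscillator.IsAdmissibleDamping p)
    (hf : LocallyIntegrableOn f (Ici 0))
    (hx : DampedOscillator.IsRestSolution p f ω x) :
    ((Tendsto (DampedOscillator.y₁ f ω) atTop (𝓝 0) ∧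
        (fun t => ∫ s in (0 : ℝ)..t,
          Real.cos (ω * s) * DampedOscillator.A p s * DampedOscillator.y₁ f ω s)
            =o[atTop] DampedOscillator.A p ∧
        (fun t => ∫ s in (0 : ℝ)..t,
          Real.sin (ω * s) * DampedOscillator.A p s * DampedOscillator.y₁ f ω s)
            =o[atTop] DampedOscillator.A p) ↔
      (Tendsto x atTop (𝓝 0) ∧ Tendsto (DampedOscillator.velocity x) atTop (𝓝 0))) ∧
    ((Tendsto (DampedOscillator.y₁ f ω) atTop (𝓝 0) ∧
        Tendsto (fun t => ∫ s in (0 : ℝ)..t,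
          DampedOscillator.E p t s * DampedOscillator.L₁ ω t s * DampedOscillator.y₁ f ω s)
            atTop (𝓝 0) ∧
        Tendsto (fun t => ∫ s in (0 : ℝ)..t,
          DampedOscillator.E p t s * DampedOscillator.L₂ ω t s * DampedOscillator.y₁ f ω s)
            atTop (𝓝 0)) ↔
      (Tendsto x atTop (𝓝 0) ∧ Tendsto (DampedOscillator.velocity x) atTop (𝓝 0))) := by
  have h := hx.isLittleO_response_iff hω hp hf
  constructor
  · exact ⟨fun ⟨hy, hC, hS⟩ => (h hy).1 ⟨hC, hS⟩, fun hxv =>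
      have hy := hx.tendsto_y₁ hω hp hf hxv.1 hxv.2
      ⟨hy, (h hy).2 hxv⟩⟩
  · rw [← hx.isLittleO_response_iff_tendsto_kernel hω hp hf]
    exact ⟨fun ⟨hy, hCS⟩ => (h hy).1 hCS, fun hxv =>
      have hy := hx.tendsto_y₁ hω hp hf hxv.1 hxv.2
      ⟨hy, (h hy).2 hxv⟩⟩
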